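/- Let $(X,d)$ be a complete metric space, let $F_i : X \to X$ ($i \in \mathbb N = \{1,2,\dots\}$) be contractions, i.e. for each $i$ there is $c_i<1$ with $d(F_i(x),F_i(y)) \le c_i\, d(x,y)$ for all $x,y$ (it is not assumed that $\sup_i c_i<1$), and let $x_i$ be the fixed point of $F_i$ and $D=\{x_i : i\in\mathbb N\}$. Let $\rho_i\in(0,1)$ with $\sum_{i}\rho_i=1$. A Borel probability measure $\mu$ on $X$ is called invariant for $(\mathcal F,\rho)$ if $\mu(E)=\sum_{i}\rho_i\,\mu(F_i^{-1}(E))$ for all Borel sets $E$; its support is the set of points all of whose neighbourhoods have positive measure. A non-empty set $A\subset X$ is called invariant for $\mathcal F$ if $A=\overline{\bigcup_{i}F_i(A)}$. Suppose that $\mu$ is an invariant Borel probability measure for $(\mathcal F,\rho)$ with bounded support. Then: 1. $D$ is bounded; 2. $\sum_{i}\rho_i\, d(x_1,x_i)<\infty$; 3. $\mu$ belongs to the class $M_s(X)$ of Borel probability measures that are carried by a separable Borel set and for which every Lipschitz function $f:X\to\mathbb R$ is integrable, and $\mu$ is the only invariant Borel probability measure for $(\mathcal F,\rho)$ on $X$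 (in particular, the only one in $M_s(X)$). This uniqueness holds even though invariant sets need not be unique: there exist contractions $F_i:\mathbb R\to\mathbb R$ ($i\in\mathbb N$), weights $\rho_i$ as above and an invariant Borel probability measure with bounded support for which $\mathcal F$ has two different bounded invariant sets. -/

import Mathlib

open MeasureTheory

noncomputable section

namespace CountableIFS

variable {X : Type*}

/-- `f` is a contraction: it is Lipschitz with some constant strictly smaller than `1`. -/
def IsContraction [MetricSpace X] (f : X → X) : Prop :=
  ∃ c : NNReal, ContractingWith c f

/-- A probability sequence: weights in the open interval `(0, 1)` with sum `1`. -/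
structure IsProbabilitySequence (ρ : ℕ → ℝ) : Prop where
  pos : ∀ i, 0 < ρ i
  lt_one : ∀ i, ρ i < 1
  hasSum : HasSum ρ 1

/-- The set `D` of the fixed points of the members of the family. -/
def fixedPointSet (F : ℕ → X → X) : Set X :=
  {x | ∃ i, Function.IsFixedPt (F i) x}

/-- An invariant set: non-empty, and equal to the closure of the union of its images. -/
def IsInvariantSet [MetricSpace X] (F : ℕ → X → X) (E : Set X) : Prop :=
  E.Nonempty ∧ E = closure (⋃ i, F i '' E)

/-- An invariant measure: `μ = ∑ i, ρ i • (F i)♯ μ` as Borel measures. -/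
def IsInvariantMeasure [MeasurableSpace X] (F : ℕ → X → X) (ρ : ℕ → ℝ)
    (μ : Measure X) : Prop :=
  μ = Measure.sum (fun i => ENNReal.ofReal (ρ i) • μ.map (F i))

/-- A measure is separable if it is carried by a separable Borel set. -/
def IsSeparableMeasure [MetricSpace X] [MeasurableSpace X] (μ : Measure X) : Prop :=
  ∃ A : Set X, MeasurableSet A ∧ TopologicalSpace.IsSeparable A ∧ μ Aᶜ = 0

/-- The class `M_s(X)` of the separable probability measures for which every real-valued
Lipschitz function is integrable. -/
structure MemMs [MetricSpace X] [MeasurableSpace X] (μ : Measure X) : Prop where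
  isProbabilityMeasure : IsProbabilityMeasure μ
  isSeparable : IsSeparableMeasure μ
  integrable : ∀ (f : X → ℝ) (L : NNReal), LipschitzWith L f → Integrable f μ

end CountableIFS

end

open MeasureTheory Filter Topology Set
open scoped ENNReal NNReal

namespace CountableIFS

/-! Averaging `f ↦ ∑ ρ i • f ∘ F i` preserves integrals against invariant measures and turns a
modulus of continuity `ω` into `t ↦ ∑ ρ i * ω (c i * t)`. Although `sup c i` may be 1, iterating
from `min 1 t` gives 0 in the limit (`iInf_modulus_eq_zero`). So averages of a bounded Lipschitz
function become nearly constant, and two invariant probability measures integrate it alike.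
Truncation at 1 supplies the domination, so no moment condition is needed.

The same moduli, applied to the distance from a countable orbit, show that `μ` is carried by the
orbit's closure. Hence `μ` is separable and its support has full measure. The support is then
non-empty, closed and mapped into itself by each `F i`, so it contains every fixed point;
boundedness of the support gives the remaining claims. -/

/-- The probability measure on `ℕ` with weights `ρ`. -/
noncomputable def weightMeasure (ρ : ℕ → ℝ) : Measure ℕ :=
  Measure.sum fun i => ENNReal.ofReal (ρ i) • Measure.dirac i

lemma lintegral_weightMeasure (ρ : ℕ → ℝ) (g : ℕ → ℝ≥0∞) :
    ∫⁻ i, g i ∂weightMeasure ρ = ∑' i, ENNReal.ofReal (ρ i) * g i := by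
  simp [weightMeasure, lintegral_sum_measure]

lemma IsProbabilitySequence.isProbabilityMeasure {ρ : ℕ → ℝ} (hρ : IsProbabilitySequence ρ) :
    IsProbabilityMeasure (weightMeasure ρ) := by
  refine ⟨?_⟩
  rw [← lintegral_one, lintegral_weightMeasure]
  simp only [mul_one]
  rw [← ENNReal.ofReal_tsum_of_nonneg (fun i => (hρ.pos i).le) hρ.hasSum.summable,
    hρ.hasSum.tsum_eq, ENNReal.ofReal_one]

lemma IsProbabilitySequence.forall_of_ae {ρ : ℕ → ℝ} (hρ : IsProbabilitySequence ρ)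
    {P : ℕ → Prop} (h : ∀ᵐ i ∂weightMeasure ρ, P i) (i : ℕ) : P i := by
  by_contra hi
  have h0 : weightMeasure ρ {i} = 0 := measure_mono_null (by simpa using hi) h
  have h1 : ENNReal.ofReal (ρ i) ≤ weightMeasure ρ {i} := by
    rw [weightMeasure, Measure.sum_apply _ (measurableSet_singleton i)]
    refine le_trans ?_ (ENNReal.le_tsum i)
    simp
  rw [h0, nonpos_iff_eq_zero, ENNReal.ofReal_eq_zero] at h1
  exact absurd (hρ.pos i) (not_lt.2 h1)

/-- The iterates of the averaging operator `h ↦ ∑ i, ρ i * h (c i * ·)` on moduli of continuity,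
applied to `t ↦ min 1 t`. -/
noncomputable def modulus (ρ : ℕ → ℝ) (c : ℕ → ℝ≥0) : ℕ → ℝ≥0∞ → ℝ≥0∞
  | 0, t => min 1 t
  | n + 1, t => ∫⁻ i, modulus ρ c n (c i * t) ∂weightMeasure ρ

/-! ### Decay of the averaged moduli of continuity -/

section Modulus

variable {ρ : ℕ → ℝ} {c : ℕ → ℝ≥0}

lemma modulus_mono (ρ : ℕ → ℝ) (c : ℕ → ℝ≥0) (n : ℕ) : Monotone (modulus ρ c n) := by
  induction n with
  | zero => exact fun s t h => min_le_min le_rfl h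
  | succ n ih => exact fun s t h => lintegral_mono fun i => ih (mul_le_mul_right h _)

lemma measurable_modulus_comp {α : Type*} [MeasurableSpace α] (n : ℕ) {u : α → ℝ≥0∞}
    (hu : Measurable u) : Measurable fun x => modulus ρ c n (u x) :=
  (modulus_mono ρ c n).measurable.comp hu

lemma mul_le_of_lt_one (hc : ∀ i, c i < 1) (i : ℕ) (t : ℝ≥0∞) : (c i : ℝ≥0∞) * t ≤ t :=
  mul_le_of_le_one_left' (by exact_mod_cast (hc i).le)

lemma modulus_succ_le (hρ : IsProbabilitySequence ρ) (hc : ∀ i, c i < 1) (n : ℕ) (t : ℝ≥0∞) :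
    modulus ρ c (n + 1) t ≤ modulus ρ c n t := by
  have := hρ.isProbabilityMeasure
  calc modulus ρ c (n + 1) t ≤ ∫⁻ _, modulus ρ c n t ∂weightMeasure ρ :=
        lintegral_mono fun i => modulus_mono ρ c n (mul_le_of_lt_one hc i t)
    _ = modulus ρ c n t := by simp

lemma modulus_antitone (hρ : IsProbabilitySequence ρ) (hc : ∀ i, c i < 1) :
    Antitone (modulus ρ c) :=
  antitone_nat_of_succ_le fun n t => modulus_succ_le hρ hc n t

lemma modulus_le_min (hρ : IsProbabilitySequence ρ) (hc : ∀ i, c i < 1) (n : ℕ) (t : ℝ≥0∞) :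
    modulus ρ c n t ≤ min 1 t :=
  modulus_antitone hρ hc (Nat.zero_le n) t

lemma lintegral_modulus_ne_top {α : Type*} [MeasurableSpace α] (μ : Measure α) [IsFiniteMeasure μ]
    (hρ : IsProbabilitySequence ρ) (hc : ∀ i, c i < 1) (n : ℕ) (u : α → ℝ≥0∞) :
    ∫⁻ x, modulus ρ c n (u x) ∂μ ≠ ∞ := by
  refine ((lintegral_mono fun x => (modulus_le_min hρ hc n (u x)).trans
    (min_le_left _ _)).trans_lt ?_).ne
  simp

/-- The limit `ψ` is monotone, so each `ψ (c i * t)` is at most `ψ t`; yet their weighted mean is at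
least `ψ t`. As all weights are positive, equality holds for every `i`. -/
lemma iInf_modulus_mul (hρ : IsProbabilitySequence ρ) (hc : ∀ i, c i < 1) (t : ℝ≥0∞) (i : ℕ) :
    ⨅ n, modulus ρ c n (c i * t) = ⨅ n, modulus ρ c n t := by
  have := hρ.isProbabilityMeasure
  set ψ : ℝ≥0∞ → ℝ≥0∞ := fun t => ⨅ n, modulus ρ c n t with hψ
  have hfin : ∀ s, ψ s ≠ ∞ := fun s =>
    (((iInf_le _ 0).trans (min_le_left _ _)).trans_lt ENNReal.one_lt_top).ne
  have hle : ∀ j, ψ (c j * t) ≤ ψ t := fun j =>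
    iInf_mono fun n => modulus_mono ρ c n (mul_le_of_lt_one hc j t)
  have hint : ∫⁻ j, ψ (c j * t) ∂weightMeasure ρ = ⨅ n, modulus ρ c (n + 1) t :=
    lintegral_iInf (fun n => Measurable.of_discrete)
      (fun m n h j => modulus_antitone hρ hc h _)
      (lintegral_modulus_ne_top _ hρ hc 0 _)
  have hge : ψ t ≤ ∫⁻ j, ψ (c j * t) ∂weightMeasure ρ := by
    rw [hint]
    exact le_iInf fun n => iInf_le _ (n + 1)
  have hae : (fun j => ψ (c j * t)) =ᵐ[weightMeasure ρ] fun _ => ψ t := by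
    refine ae_eq_of_ae_le_of_lintegral_le (ae_of_all _ hle) ?_ aemeasurable_const
      (by simpa using hge)
    refine ((lintegral_mono hle).trans_lt ?_).ne
    simpa using (hfin t).lt_top
  exact hρ.forall_of_ae hae i

/-- A single ratio suffices: the limit at `t` equals the limit at `c 0 ^ k * t`, which is at most `c
0 ^ k * t`. -/
lemma iInf_modulus_eq_zero (hρ : IsProbabilitySequence ρ) (hc : ∀ i, c i < 1) {t : ℝ≥0∞}
    (ht : t ≠ ∞) : ⨅ n, modulus ρ c n t = 0 := by
  have key : ∀ k : ℕ, ⨅ n, modulus ρ c n ((c 0 : ℝ≥0∞) ^ k * t) = ⨅ n, modulus ρ c n t := by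
    intro k
    induction k with
    | zero => simp
    | succ k ih => rw [pow_succ', mul_assoc, iInf_modulus_mul hρ hc, ih]
  have hlim : Tendsto (fun k : ℕ => (c 0 : ℝ≥0∞) ^ k * t) atTop (𝓝 (0 * t)) :=
    ENNReal.Tendsto.mul_const
      (ENNReal.tendsto_pow_atTop_nhds_zero_of_lt_one (by exact_mod_cast hc 0)) (Or.inr ht)
  rw [zero_mul] at hlim
  refine le_antisymm (ge_of_tendsto' hlim fun k => ?_) zero_le
  rw [← key k]
  exact (iInf_le _ 0).trans (min_le_right _ _)

lemma iInf_lintegral_modulus {α : Type*} [MeasurableSpace α] (μ : Measure α) [IsFiniteMeasure μ]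
    (hρ : IsProbabilitySequence ρ) (hc : ∀ i, c i < 1) {u : α → ℝ≥0∞} (hu : Measurable u)
    (hfin : ∀ x, u x ≠ ∞) : ⨅ n, ∫⁻ x, modulus ρ c n (u x) ∂μ = 0 := by
  rw [← lintegral_iInf (fun n => measurable_modulus_comp n hu)
    (fun m n h x => modulus_antitone hρ hc h _) (lintegral_modulus_ne_top μ hρ hc 0 u)]
  simp [iInf_modulus_eq_zero hρ hc (hfin _)]

lemma tendsto_lintegral_modulus {α : Type*} [MeasurableSpace α] (μ : Measure α)
    [IsFiniteMeasure μ] (hρ : IsProbabilitySequence ρ) (hc : ∀ i, c i < 1) {u : α → ℝ≥0∞}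
    (hu : Measurable u) (hfin : ∀ x, u x ≠ ∞) :
    Tendsto (fun n => ∫⁻ x, modulus ρ c n (u x) ∂μ) atTop (𝓝 0) := by
  rw [← iInf_lintegral_modulus μ hρ hc hu hfin]
  exact tendsto_atTop_iInf fun m n h => lintegral_mono fun x => modulus_antitone hρ hc h _

end Modulus

/-- The set of the images of `x₀` under all finite compositions of the maps `F i`. -/
def orbit {X : Type*} (F : ℕ → X → X) (x₀ : X) : Set X :=
  range fun l : List ℕ => l.foldr F x₀

lemma countable_orbit {X : Type*} (F : ℕ → X → X) (x₀ : X) : (orbit F x₀).Countable :=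
  countable_range _

/-! ### Orbits, Lipschitz approximation and supports in metric spaces -/

section Metric

variable {X : Type*} [MetricSpace X]

lemma infEDist_orbit_le {F : ℕ → X → X} {c : ℕ → ℝ≥0}
    (hF : ∀ i, LipschitzWith (c i) (F i)) (x₀ x : X) (i : ℕ) :
    Metric.infEDist (F i x) (orbit F x₀) ≤ c i * Metric.infEDist x (orbit F x₀) := by
  simp only [Metric.infEDist, orbit, iInf_range]
  rw [ENNReal.mul_iInf fun h => absurd h ENNReal.coe_ne_top]
  exact le_iInf fun l => (iInf_le _ (i :: l)).trans ((hF i).edist_le_mul x _)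

lemma fixedPoint_mem_of_mapsTo {K : ℝ≥0} {f : X → X} (hf : ContractingWith K f) {S : Set X}
    (hS : IsClosed S) (hne : S.Nonempty) (hmaps : MapsTo f S S) {x : X}
    (hx : Function.IsFixedPt f x) : x ∈ S := by
  obtain ⟨s, hs⟩ := hne
  have hlim : Tendsto (fun n : ℕ => (K : ℝ≥0∞) ^ n * edist s x) atTop (𝓝 (0 * edist s x)) :=
    ENNReal.Tendsto.mul_const
      (ENNReal.tendsto_pow_atTop_nhds_zero_of_lt_one (by exact_mod_cast hf.1))
      (Or.inr (edist_ne_top _ _))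
  rw [zero_mul] at hlim
  have hconv : Tendsto (fun n => f^[n] s) atTop (𝓝 x) := by
    rw [tendsto_iff_edist_tendsto_0]
    refine tendsto_of_tendsto_of_tendsto_of_le_of_le tendsto_const_nhds hlim
      (fun _ => zero_le) fun n => ?_
    have := (hf.2.iterate n).edist_le_mul s x
    rw [(hx.iterate n).eq] at this
    simpa using this
  exact hS.mem_of_tendsto hconv (Eventually.of_forall fun n => hmaps.iterate n hs)

lemma iSup_min_infEDist_compl {U : Set X} (hU : IsOpen U) (x : X) :
    ⨆ k : ℕ, min 1 ((k : ℝ≥0∞) * Metric.infEDist x Uᶜ) = U.indicator 1 x := by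
  by_cases hx : x ∈ U
  · have hpos : Metric.infEDist x Uᶜ ≠ 0 := by
      rw [Ne, ← Metric.mem_iff_infEDist_zero_of_closed hU.isClosed_compl]
      simpa using hx
    rw [indicator_of_mem hx, Pi.one_apply]
    refine le_antisymm (iSup_le fun k => min_le_left _ _) ?_
    obtain ⟨k, hk⟩ := ENNReal.exists_nat_mul_gt hpos ENNReal.one_ne_top
    exact le_iSup_of_le k (le_min le_rfl hk.le)
  · have h0 : Metric.infEDist x Uᶜ = 0 := Metric.infEDist_zero_of_mem hx
    simp [hx, h0]

lemma min_mul_infEDist_le (k : ℝ≥0∞) (s : Set X) (x y : X) :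
    min 1 (k * Metric.infEDist x s) ≤
      min 1 (k * Metric.infEDist y s) + min 1 (k * edist x y) := by
  have h : k * Metric.infEDist x s ≤ k * Metric.infEDist y s + k * edist x y := by
    rw [← mul_add]
    exact mul_le_mul_right Metric.infEDist_le_infEDist_add_edist _
  rcases le_total 1 (k * Metric.infEDist y s) with h1 | h1
  · rw [min_eq_left h1]
    exact (min_le_left _ _).trans le_self_add
  rcases le_total 1 (k * edist x y) with h2 | h2
  · rw [min_eq_left h2]
    exact (min_le_left _ _).trans le_add_self
  rw [min_eq_right h1, min_eq_right h2]
  exact (min_le_right _ _).trans h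

/-- The complement of the support can have positive measure in a non-separable space. Here countably
many null balls, with centres in `A` and radii `1 / (n + 1)`, cover its part inside `closure A`. -/
lemma measure_compl_support_of_countable [MeasurableSpace X] {μ : Measure X} {A : Set X}
    (hA : A.Countable) (h : μ (closure A)ᶜ = 0) : μ μ.supportᶜ = 0 := by
  have hcov : μ.supportᶜ ⊆ (closure A)ᶜ ∪
      ⋃ p ∈ {p : X × ℕ | p.1 ∈ A ∧ μ (Metric.ball p.1 (1 / (p.2 + 1))) = 0},
        Metric.ball p.1 (1 / (p.2 + 1)) := by
    intro x hx
    by_cases hxA : x ∈ closure A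
    · right
      obtain ⟨U, hU, hU0⟩ := Measure.notMem_support_iff_exists.1 hx
      obtain ⟨ε, hε, hεU⟩ := Metric.mem_nhds_iff.1 hU
      obtain ⟨n, hn⟩ := exists_nat_one_div_lt (half_pos hε)
      obtain ⟨a, haA, hxa⟩ := Metric.mem_closure_iff.1 hxA (1 / ((n : ℝ) + 1)) (by positivity)
      refine mem_iUnion₂.2 ⟨(a, n), ⟨haA, measure_mono_null ?_ hU0⟩, hxa⟩
      refine (Metric.ball_subset_ball' ?_).trans hεU
      rw [dist_comm]
      linarith
    · exact Or.inl hxA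
  refine measure_mono_null hcov (measure_union_null h ?_)
  have hcount : {p : X × ℕ | p.1 ∈ A ∧ μ (Metric.ball p.1 (1 / (p.2 + 1))) = 0}.Countable :=
    (hA.prod (countable_univ (α := ℕ))).mono fun _ hp => mem_prod.2 ⟨hp.1, mem_univ _⟩
  exact (measure_biUnion_null_iff hcount).2 fun p hp => hp.2

end Metric

/-! ### Invariant measures: concentration and uniqueness -/

section Invariant

variable {X : Type*} [MeasurableSpace X] {F : ℕ → X → X} {ρ : ℕ → ℝ} {μ : Measure X}

lemma IsInvariantMeasure.lintegral_eq (hμ : IsInvariantMeasure F ρ μ)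
    (hF : ∀ i, Measurable (F i)) {f : X → ℝ≥0∞} (hf : Measurable f) :
    ∫⁻ x, f x ∂μ = ∫⁻ i, ∫⁻ x, f (F i x) ∂μ ∂weightMeasure ρ := by
  conv_lhs => rw [hμ]
  rw [lintegral_sum_measure, lintegral_weightMeasure]
  simp [lintegral_map hf (hF _)]

lemma IsInvariantMeasure.lintegral_average [SFinite μ] (hμ : IsInvariantMeasure F ρ μ)
    (hρ : IsProbabilitySequence ρ) (hF : ∀ i, Measurable (F i)) {f : X → ℝ≥0∞}
    (hf : Measurable f) :
    ∫⁻ x, ∫⁻ i, f (F i x) ∂weightMeasure ρ ∂μ = ∫⁻ x, f x ∂μ := by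
  have := hρ.isProbabilityMeasure
  rw [hμ.lintegral_eq hF hf, lintegral_lintegral_swap]
  exact (measurable_from_prod_countable_left fun i => hf.comp (hF i)).aemeasurable

/-- By invariance the integrals of `modulus ρ c n (u x)` increase with `n`, but their infimum is 0;
so already that of `min 1 (u x)` vanishes. -/
lemma IsInvariantMeasure.ae_eq_zero [IsFiniteMeasure μ] {c : ℕ → ℝ≥0}
    (hμ : IsInvariantMeasure F ρ μ) (hρ : IsProbabilitySequence ρ) (hc : ∀ i, c i < 1)
    (hF : ∀ i, Measurable (F i)) {u : X → ℝ≥0∞} (hu : Measurable u) (hfin : ∀ x, u x ≠ ∞)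
    (hle : ∀ i x, u (F i x) ≤ c i * u x) : ∀ᵐ x ∂μ, u x = 0 := by
  have step : ∀ n, ∫⁻ x, modulus ρ c n (u x) ∂μ ≤ ∫⁻ x, modulus ρ c (n + 1) (u x) ∂μ := by
    intro n
    rw [← hμ.lintegral_average hρ hF (measurable_modulus_comp n hu)]
    exact lintegral_mono fun x => lintegral_mono fun i => modulus_mono ρ c n (hle i x)
  have h0 : ∫⁻ x, modulus ρ c 0 (u x) ∂μ = 0 := by
    refine le_antisymm ?_ zero_le
    rw [← iInf_lintegral_modulus μ hρ hc hu hfin]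
    exact le_iInf fun n => monotone_nat_of_le_succ step (Nat.zero_le n)
  rw [lintegral_eq_zero_iff (measurable_modulus_comp 0 hu)] at h0
  filter_upwards [h0] with x hx
  have hx : min 1 (u x) = 0 := hx
  simpa using hx

variable [MetricSpace X] [BorelSpace X] {c : ℕ → ℝ≥0}

lemma IsInvariantMeasure.measure_compl_closure_orbit [IsFiniteMeasure μ]
    (hμ : IsInvariantMeasure F ρ μ) (hρ : IsProbabilitySequence ρ) (hc : ∀ i, c i < 1)
    (hF : ∀ i, LipschitzWith (c i) (F i)) (x₀ : X) : μ (closure (orbit F x₀))ᶜ = 0 := by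
  have h := hμ.ae_eq_zero hρ hc (fun i => (hF i).continuous.measurable)
    (u := fun x => Metric.infEDist x (orbit F x₀)) Metric.continuous_infEDist.measurable
    (fun x => Metric.infEDist_ne_top (range_nonempty _)) fun i x => infEDist_orbit_le hF x₀ x i
  simp only [← Metric.mem_closure_iff_infEDist_zero] at h
  exact h

lemma IsInvariantMeasure.mapsTo_support (hμ : IsInvariantMeasure F ρ μ)
    (hρ : IsProbabilitySequence ρ) (hF : ∀ i, Continuous (F i)) (i : ℕ) :
    MapsTo (F i) μ.support μ.support := by
  intro x hx
  rw [Measure.support_eq_forall_isOpen] at hx ⊢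
  intro U hxU hU
  have hpos := hx (F i ⁻¹' U) hxU (hU.preimage (hF i))
  have hle : ENNReal.ofReal (ρ i) * μ (F i ⁻¹' U) ≤ μ U := by
    conv_rhs => rw [hμ, Measure.sum_apply _ hU.measurableSet]
    refine le_trans ?_ (ENNReal.le_tsum i)
    simp [Measure.map_apply (hF i).measurable hU.measurableSet]
  exact (ENNReal.mul_pos (by simpa using hρ.pos i) hpos.ne').trans_le hle

/-- Averaging a function improves its modulus of continuity and preserves its integral against
every invariant measure. -/
lemma exists_modulus_of_invariant [SFinite μ] {ν : Measure X} [SFinite ν]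
    (hμ : IsInvariantMeasure F ρ μ) (hν : IsInvariantMeasure F ρ ν)
    (hρ : IsProbabilitySequence ρ) (hF : ∀ i, LipschitzWith (c i) (F i)) (k : ℝ≥0∞)
    {f : X → ℝ≥0∞} (hf : Measurable f) (hfk : ∀ x y, f x ≤ f y + min 1 (k * edist x y)) (n : ℕ) :
    ∃ g : X → ℝ≥0∞, Measurable g ∧ (∀ x y, g x ≤ g y + modulus ρ c n (k * edist x y)) ∧
      ∫⁻ x, g x ∂μ = ∫⁻ x, f x ∂μ ∧ ∫⁻ x, g x ∂ν = ∫⁻ x, f x ∂ν := by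
  have := hρ.isProbabilityMeasure
  have hFm : ∀ i, Measurable (F i) := fun i => (hF i).continuous.measurable
  induction n with
  | zero => exact ⟨f, hf, hfk, rfl, rfl⟩
  | succ n ih =>
    obtain ⟨g, hg, hgn, hgμ, hgν⟩ := ih
    refine ⟨fun x => ∫⁻ i, g (F i x) ∂weightMeasure ρ, ?_, fun x y => ?_, ?_, ?_⟩
    · exact Measurable.lintegral_prod_right
        (f := fun (x : X) (i : ℕ) => g (F i x))
        (measurable_from_prod_countable_left fun i => hg.comp (hFm i))
    · rw [modulus, ← lintegral_add_left Measurable.of_discrete]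
      refine lintegral_mono fun i => (hgn _ _).trans (add_le_add_right ?_ _)
      refine modulus_mono ρ c n ?_
      rw [mul_left_comm]
      exact mul_le_mul_right ((hF i).edist_le_mul x y) _
    · rw [hμ.lintegral_average hρ hFm hg, hgμ]
    · rw [hν.lintegral_average hρ hFm hg, hgν]

lemma lintegral_le_of_invariant [IsProbabilityMeasure μ] {ν : Measure X} [IsProbabilityMeasure ν]
    (hμ : IsInvariantMeasure F ρ μ) (hν : IsInvariantMeasure F ρ ν)
    (hρ : IsProbabilitySequence ρ) (hc : ∀ i, c i < 1) (hF : ∀ i, LipschitzWith (c i) (F i))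
    {k : ℝ≥0∞} (hk : k ≠ ∞) {f : X → ℝ≥0∞} (hf : Measurable f)
    (hfk : ∀ x y, f x ≤ f y + min 1 (k * edist x y)) :
    ∫⁻ x, f x ∂μ ≤ ∫⁻ x, f x ∂ν := by
  obtain ⟨x₀⟩ : Nonempty X := nonempty_of_isProbabilityMeasure μ
  have hu : Measurable fun x => k * edist x x₀ :=
    (continuous_id.edist continuous_const).measurable.const_mul k
  have hfin : ∀ x, k * edist x x₀ ≠ ∞ := fun x => ENNReal.mul_ne_top hk (edist_ne_top _ _)
  have hbound : ∀ n, ∫⁻ x, f x ∂μ ≤ ∫⁻ x, f x ∂ν +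
      (∫⁻ x, modulus ρ c n (k * edist x x₀) ∂ν + ∫⁻ x, modulus ρ c n (k * edist x x₀) ∂μ) := by
    intro n
    obtain ⟨g, hg, hgn, hgμ, hgν⟩ := exists_modulus_of_invariant hμ hν hρ hF k hf hfk n
    have h1 : ∫⁻ x, g x ∂μ ≤ g x₀ + ∫⁻ x, modulus ρ c n (k * edist x x₀) ∂μ := by
      calc ∫⁻ x, g x ∂μ ≤ ∫⁻ x, (g x₀ + modulus ρ c n (k * edist x x₀)) ∂μ :=
            lintegral_mono fun x => hgn x x₀
        _ = _ := by rw [lintegral_add_left measurable_const]; simp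
    have h2 : g x₀ ≤ ∫⁻ x, g x ∂ν + ∫⁻ x, modulus ρ c n (k * edist x x₀) ∂ν := by
      calc g x₀ = ∫⁻ _, g x₀ ∂ν := by simp
        _ ≤ ∫⁻ x, (g x + modulus ρ c n (k * edist x x₀)) ∂ν :=
            lintegral_mono fun x => by rw [edist_comm]; exact hgn x₀ x
        _ = _ := lintegral_add_left hg _
    -- Both integrals of the averaged function `g` are compared with its value at `x₀`.
    rw [← hgμ, ← hgν, ← add_assoc]
    exact h1.trans (add_le_add_left h2 _)
  have hlim := (tendsto_lintegral_modulus ν hρ hc hu hfin).add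
    (tendsto_lintegral_modulus μ hρ hc hu hfin)
  simpa using ge_of_tendsto' (hlim.const_add (∫⁻ x, f x ∂ν)) hbound

/-- The indicator of `U` is the increasing limit of the truncated Lipschitz functions `min 1 (k *
infEDist x Uᶜ)`. -/
lemma measure_open_le_of_invariant [IsProbabilityMeasure μ] {ν : Measure X}
    [IsProbabilityMeasure ν] (hμ : IsInvariantMeasure F ρ μ) (hν : IsInvariantMeasure F ρ ν)
    (hρ : IsProbabilitySequence ρ) (hc : ∀ i, c i < 1) (hF : ∀ i, LipschitzWith (c i) (F i))
    {U : Set X} (hU : IsOpen U) : μ U ≤ ν U := by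
  have hmeas : ∀ k : ℕ, Measurable fun x : X => min 1 ((k : ℝ≥0∞) * Metric.infEDist x Uᶜ) :=
    fun k => measurable_const.min (Metric.continuous_infEDist.measurable.const_mul _)
  have hrepr : ∀ m : Measure X,
      m U = ⨆ k : ℕ, ∫⁻ x, min 1 ((k : ℝ≥0∞) * Metric.infEDist x Uᶜ) ∂m := by
    intro m
    rw [← lintegral_indicator_one hU.measurableSet, ← lintegral_iSup hmeas]
    · exact lintegral_congr fun x => (iSup_min_infEDist_compl hU x).symm
    · exact fun k l h x => min_le_min le_rfl (mul_le_mul_left (by exact_mod_cast h) _)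
  rw [hrepr μ, hrepr ν]
  exact iSup_mono fun k => lintegral_le_of_invariant hμ hν hρ hc hF (ENNReal.natCast_ne_top k)
    (hmeas k) fun x y => min_mul_infEDist_le _ _ x y

/-- A countable family of contractions with weights has at most one invariant probability
measure. -/
theorem IsInvariantMeasure.unique [IsProbabilityMeasure μ] {ν : Measure X}
    [IsProbabilityMeasure ν] (hμ : IsInvariantMeasure F ρ μ) (hν : IsInvariantMeasure F ρ ν)
    (hρ : IsProbabilitySequence ρ) (hc : ∀ i, c i < 1) (hF : ∀ i, LipschitzWith (c i) (F i)) :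
    μ = ν :=
  ext_of_generate_finite _ BorelSpace.measurable_eq isPiSystem_isOpen
    (fun _ hU => le_antisymm (measure_open_le_of_invariant hμ hν hρ hc hF hU)
      (measure_open_le_of_invariant hν hμ hρ hc hF hU)) (by simp)

end Invariant

/-! ### An example with two bounded invariant sets -/

lemma isProbabilitySequence_geometric : IsProbabilitySequence fun i : ℕ => (1 / 2 : ℝ) / 2 ^ i where
  pos i := by positivity
  lt_one i := by
    have : (1 : ℝ) ≤ 2 ^ i := one_le_pow₀ (by norm_num)
    rw [div_lt_one (by positivity)]
    linarith
  hasSum := hasSum_geometric_two' 1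

/-- The contraction of the real line with fixed point `0` and ratio `1 - 1 / (i + 2)`. -/
noncomputable def scaling (i : ℕ) (x : ℝ) : ℝ := (1 - 1 / ((i : ℝ) + 2)) * x

lemma scaling_ratio_nonneg (i : ℕ) : 0 ≤ 1 - 1 / ((i : ℝ) + 2) := by
  rw [sub_nonneg, div_le_one (by positivity)]
  linarith [(Nat.cast_nonneg i : (0 : ℝ) ≤ i)]

lemma scaling_ratio_lt_one (i : ℕ) : 1 - 1 / ((i : ℝ) + 2) < 1 := by
  have : 0 < 1 / ((i : ℝ) + 2) := by positivity
  linarith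

lemma isContraction_scaling (i : ℕ) : IsContraction (scaling i) := by
  refine ⟨⟨1 - 1 / ((i : ℝ) + 2), scaling_ratio_nonneg i⟩, ?_, ?_⟩
  · exact_mod_cast scaling_ratio_lt_one i
  · refine LipschitzWith.of_dist_le_mul fun x y => ?_
    simp only [scaling, Real.dist_eq]
    rw [← mul_sub, abs_mul, abs_of_nonneg (scaling_ratio_nonneg i)]
    exact le_rfl

lemma isInvariantSet_scaling_singleton : IsInvariantSet scaling {0} := by
  refine ⟨singleton_nonempty 0, ?_⟩
  simp [scaling]

/-- The ratios tend to 1, so each `x` is the limit of its images `scaling i x`; the closure restores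
what every single map loses. -/
lemma isInvariantSet_scaling_Icc : IsInvariantSet scaling (Icc 0 1) := by
  refine ⟨⟨0, by simp⟩, Subset.antisymm (fun x hx => ?_) ?_⟩
  · have hlim : Tendsto (fun i : ℕ => scaling i x) atTop (𝓝 ((1 - 0) * x)) := by
      refine Tendsto.mul_const _ (tendsto_const_nhds.sub ?_)
      have := (tendsto_one_div_add_atTop_nhds_zero_nat (𝕜 := ℝ)).comp (tendsto_add_atTop_nat 1)
      refine this.congr fun i => ?_
      simp only [Function.comp_apply, Nat.cast_add, Nat.cast_one]
      ring_nf
    rw [sub_zero, one_mul] at hlim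
    exact mem_closure_of_tendsto hlim
      (Eventually.of_forall fun i => mem_iUnion.2 ⟨i, mem_image_of_mem _ hx⟩)
  · refine closure_minimal (iUnion_subset fun i => ?_) isClosed_Icc
    rintro _ ⟨x, hx, rfl⟩
    exact ⟨mul_nonneg (scaling_ratio_nonneg i) hx.1,
      mul_le_one₀ (scaling_ratio_lt_one i).le hx.1 hx.2⟩

lemma isInvariantMeasure_scaling_dirac {ρ : ℕ → ℝ} (hρ : IsProbabilitySequence ρ) :
    IsInvariantMeasure scaling ρ (Measure.dirac (0 : ℝ)) := by
  have hmap : ∀ i, (Measure.dirac (0 : ℝ)).map (scaling i) = Measure.dirac 0 := by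
    intro i
    rw [Measure.map_dirac' (by unfold scaling; fun_prop)]
    simp [scaling]
  have hsum : ∑' i, ENNReal.ofReal (ρ i) = 1 := by
    rw [← ENNReal.ofReal_tsum_of_nonneg (fun i => (hρ.pos i).le) hρ.hasSum.summable,
      hρ.hasSum.tsum_eq, ENNReal.ofReal_one]
  ext s hs
  rw [Measure.sum_apply _ hs]
  simp only [hmap, Measure.smul_apply, smul_eq_mul]
  rw [ENNReal.tsum_mul_right, hsum, one_mul]

lemma support_dirac_subset : (Measure.dirac (0 : ℝ)).support ⊆ {0} :=
  Measure.support_subset_of_isClosed isClosed_singleton (by simp)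

end CountableIFS

open CountableIFS

theorem mainTheorem8 :
    (∀ (X : Type*) [MetricSpace X] [CompleteSpace X] [MeasurableSpace X] [BorelSpace X]
      (F : ℕ → X → X) (_ : ∀ i, CountableIFS.IsContraction (F i))
      (ρ : ℕ → ℝ) (_ : CountableIFS.IsProbabilitySequence ρ)
      (μ : MeasureTheory.Measure X) (_ : MeasureTheory.IsProbabilityMeasure μ)
      (_ : CountableIFS.IsInvariantMeasure F ρ μ)
      (_ : Bornology.IsBounded μ.support),
      Bornology.IsBounded (CountableIFS.fixedPointSet F) ∧
      (∀ x : ℕ → X, (∀ i, Function.IsFixedPt (F i) (x i)) →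
        Summable (fun i => ρ i * dist (x 0) (x i))) ∧
      CountableIFS.MemMs μ ∧
      (∀ ν : MeasureTheory.Measure X, MeasureTheory.IsProbabilityMeasure ν →
        CountableIFS.IsInvariantMeasure F ρ ν → ν = μ)) ∧
    (∃ (F : ℕ → ℝ → ℝ) (ρ : ℕ → ℝ) (μ : MeasureTheory.Measure ℝ),
      (∀ i, CountableIFS.IsContraction (F i)) ∧
      CountableIFS.IsProbabilitySequence ρ ∧
      MeasureTheory.IsProbabilityMeasure μ ∧
      CountableIFS.IsInvariantMeasure F ρ μ ∧
      Bornology.IsBounded μ.support ∧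
      ∃ A B : Set ℝ, Bornology.IsBounded A ∧ Bornology.IsBounded B ∧
        CountableIFS.IsInvariantSet F A ∧ CountableIFS.IsInvariantSet F B ∧ A ≠ B) := by
  constructor
  · intro X _ _ _ _ F hF ρ hρ μ _ hμ hbdd
    choose c hcF using hF
    have hc : ∀ i, c i < 1 := fun i => (hcF i).1
    have hL : ∀ i, LipschitzWith (c i) (F i) := fun i => (hcF i).2
    obtain ⟨x₀⟩ : Nonempty X := nonempty_of_isProbabilityMeasure μ
    have hA : μ (closure (orbit F x₀))ᶜ = 0 := hμ.measure_compl_closure_orbit hρ hc hL x₀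
    have hS : μ μ.supportᶜ = 0 := measure_compl_support_of_countable (countable_orbit F x₀) hA
    have hSae : ∀ᵐ x ∂μ, x ∈ μ.support := hS
    have hne : μ.support.Nonempty := hSae.exists
    have hfix : fixedPointSet F ⊆ μ.support := fun x ⟨i, hx⟩ =>
      fixedPoint_mem_of_mapsTo (hcF i) Measure.isClosed_support hne
        (hμ.mapsTo_support hρ (fun i => (hL i).continuous) i) hx
    refine ⟨hbdd.subset hfix, fun x hx => ?_, ⟨inferInstance, ?_, fun f L hf => ?_⟩,
      fun ν _ hν => hν.unique hμ hρ hc hL⟩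
    · refine Summable.of_nonneg_of_le (fun i => mul_nonneg (hρ.pos i).le dist_nonneg)
        (fun i => mul_le_mul_of_nonneg_left
          (Metric.dist_le_diam_of_mem hbdd (hfix ⟨0, hx 0⟩) (hfix ⟨i, hx i⟩)) (hρ.pos i).le)
        (hρ.hasSum.summable.mul_right _)
    · exact ⟨_, isClosed_closure.measurableSet, (countable_orbit F x₀).isSeparable.closure, hA⟩
    · obtain ⟨C, hC⟩ := (hf.isBounded_image hbdd).exists_norm_le
      exact Integrable.of_bound hf.continuous.measurable.aestronglyMeasurable C
        (hSae.mono fun x hx => hC _ (mem_image_of_mem f hx))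
  · refine ⟨scaling, _, Measure.dirac 0, isContraction_scaling, isProbabilitySequence_geometric,
      inferInstance, isInvariantMeasure_scaling_dirac isProbabilitySequence_geometric,
      Bornology.isBounded_singleton.subset support_dirac_subset, {0}, Icc 0 1,
      Bornology.isBounded_singleton, Metric.isBounded_Icc 0 1, isInvariantSet_scaling_singleton,
      isInvariantSet_scaling_Icc, fun h => ?_⟩
    have h1 : (1 : ℝ) ∈ ({0} : Set ℝ) := h ▸ right_mem_Icc.2 zero_le_one
    exact one_ne_zero h1
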